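/- Let $n = a_1 + \cdots + a_k$, $a_1 \ge \cdots \ge a_k \ge 1$, be a partition of a positive integer $n$ into $k$ not necessarily distinct odd parts, and let $\ell$ be the number of distinct values among the parts. Write $a_i = 2r_i - 1$. The major half of the center-justified Ferrers diagram (the central column and the dots to its right) is the Ferrers diagram with row lengths $r_1 \ge \cdots \ge r_k$. The minor half (the dots strictly to the left of the central column, left-justified) is the Ferrers diagram with row lengths $r_1 - 1 \ge \cdots \ge r_k - 1$, where zero rows are omitted. For a Ferrers diagram with row lengths $\rho_1 \ge \rho_2 \ge \cdots$, let $s$ be the side of its Durfee square, that is, the greatest integer $s$ with $\rho_s \ge s$ ($s = 0$ for the empty diagram). For $i = 1, \ldots, s$ the $i$-th diagonal hook number is the number of dots that lie in row $i$ on or to the right of the dot $(i,i)$, or in column $i$ on or below it. The diagonal hook numbers of the major half together with those of the minor half are the parts of a partition of $n$, the major-minor hook partition. Theorem. The major-minor hook partition consists of exactly $\ell$ pairwise disjoint maximal sequences of consecutive integers. That is, let $H$ be the set of parts of the major-minor hook partition. There are exactly $\ell$ subsets of $H$ that are maximal under inclusion among the nonempty subsets of $H$ of the form $\{a, a+1,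 \ldots, b\}$; these subsets are pairwise disjoint; and the parts of the major-minor hook partition, counted with multiplicity, are exactly the elements of these subsets, each occurring once (so the parts are distinct). -/

import Mathlib

namespace Sylvester

/-! Diagrams are Mathlib's left-justified `YoungDiagram`s; rows and columns are numbered from `0`. -/

/-- The dots of row `i` that are on or to the right of the dot `(i, j)`. -/
def arm (μ : YoungDiagram) (i j : ℕ) : Finset (ℕ × ℕ) :=
  (μ.row i).filter fun c => j ≤ c.2

/-- The dots of column `j` that are on or below the dot `(i, j)`. -/
def leg (μ : YoungDiagram) (i j : ℕ) : Finset (ℕ × ℕ) :=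
  (μ.col j).filter fun c => i ≤ c.1

/-- The hook with corner `(i, j)`. -/
def hook (μ : YoungDiagram) (i j : ℕ) : Finset (ℕ × ℕ) :=
  arm μ i j ∪ leg μ i j

/-- The hook number of `(i, j)`: the number of dots in its hook. -/
def hookNumber (μ : YoungDiagram) (i j : ℕ) : ℕ :=
  (hook μ i j).card

/-- The side of the Durfee square: the greatest `s` such that the `s`-th row (which has index
`s - 1` here) contains at least `s` dots, and `0` for the empty diagram. -/
def durfeeSide (μ : YoungDiagram) : ℕ :=
  Nat.findGreatest (fun s => s ≤ μ.rowLen (s - 1)) μ.card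

theorem lt_durfeeSide_iff (μ : YoungDiagram) (i : ℕ) : i < durfeeSide μ ↔ (i, i) ∈ μ := by
  constructor
  · intro h
    have hs : durfeeSide μ ≤ μ.rowLen (durfeeSide μ - 1) :=
      Nat.findGreatest_spec (P := fun s => s ≤ μ.rowLen (s - 1)) (Nat.zero_le μ.card)
        (Nat.zero_le _)
    have hm : (durfeeSide μ - 1, durfeeSide μ - 1) ∈ μ := by
      rw [YoungDiagram.mem_iff_lt_rowLen]; omega
    exact μ.up_left_mem (by omega) (by omega) hm
  · intro h
    have h1 : i + 1 ≤ μ.rowLen (i + 1 - 1) := by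
      simpa [YoungDiagram.mem_iff_lt_rowLen] using h
    have h2 : i + 1 ≤ μ.card := by
      refine h1.trans ?_
      rw [YoungDiagram.rowLen_eq_card]
      exact Finset.card_le_card (Finset.filter_subset _ _)
    exact Nat.le_findGreatest (P := fun s => s ≤ μ.rowLen (s - 1)) h2 h1

theorem mem_hook_diag (μ : YoungDiagram) (i : ℕ) (c : ℕ × ℕ) :
    c ∈ hook μ i i ↔ c ∈ μ ∧ min c.1 c.2 = i := by
  obtain ⟨a, b⟩ := c
  simp only [hook, arm, leg, Finset.mem_union, Finset.mem_filter, YoungDiagram.mem_row_iff,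
    YoungDiagram.mem_col_iff]
  constructor
  · rintro (⟨⟨h, h1⟩, h2⟩ | ⟨⟨h, h1⟩, h2⟩)
    · exact ⟨h, by omega⟩
    · exact ⟨h, by omega⟩
  · rintro ⟨h, h1⟩
    rcases le_total a b with hab | hab
    · exact Or.inl ⟨⟨h, by omega⟩, by omega⟩
    · exact Or.inr ⟨⟨h, by omega⟩, by omega⟩

/-- The diagonal hook numbers, which are the parts of the hook partition of the diagram. -/
def diagonalHooks (μ : YoungDiagram) : Multiset ℕ :=
  (Multiset.range (durfeeSide μ)).map fun i => hookNumber μ i i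

theorem pos_of_mem_diagonalHooks (μ : YoungDiagram) {h : ℕ} (hh : h ∈ diagonalHooks μ) :
    0 < h := by
  obtain ⟨i, hi, rfl⟩ := Multiset.mem_map.1 hh
  rw [Multiset.mem_range, lt_durfeeSide_iff] at hi
  exact Finset.card_pos.2 ⟨(i, i), (mem_hook_diag μ i _).2 ⟨hi, min_self i⟩⟩

theorem sum_diagonalHooks (μ : YoungDiagram) : (diagonalHooks μ).sum = μ.card := by
  have h := Finset.card_eq_sum_card_fiberwise (s := μ.cells)
    (t := Finset.range (durfeeSide μ)) (f := fun c => min c.1 c.2) (by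
      intro c hc
      have hc' : (c.1, c.2) ∈ μ := hc
      simp only [Finset.coe_range, Set.mem_Iio]
      rw [lt_durfeeSide_iff]
      exact μ.up_left_mem (min_le_left _ _) (min_le_right _ _) hc')
  rw [YoungDiagram.card, h]
  change ∑ i ∈ Finset.range (durfeeSide μ), hookNumber μ i i = _
  refine Finset.sum_congr rfl fun i _ => ?_
  rw [hookNumber]
  congr 1
  ext c
  rw [mem_hook_diag, Finset.mem_filter, YoungDiagram.mem_cells]

theorem card_ofRowLens (w : List ℕ) (hw : w.SortedGE) :
    (YoungDiagram.ofRowLens w hw).card = w.sum := by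
  have key : ∀ w : List ℕ, (YoungDiagram.cellsOfRowLens w).card = w.sum := by
    intro w
    induction w with
    | nil => simp [YoungDiagram.cellsOfRowLens]
    | cons a w ih =>
      rw [YoungDiagram.cellsOfRowLens, Finset.card_union_of_disjoint, Finset.card_map, ih]
      · simp
      · rw [Finset.disjoint_left]
        rintro ⟨x, y⟩ h1 h2
        simp at h1 h2
        omega
  exact key w

/-- The parts `a₁ ≥ ⋯ ≥ aₖ` of a partition in decreasing order. -/
def sortedParts {n : ℕ} (p : n.Partition) : List ℕ :=
  p.parts.sort (· ≥ ·)

theorem sortedGE_map_sortedParts {n : ℕ} (p : n.Partition) {f : ℕ → ℕ} (hf : Monotone f) :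
    ((sortedParts p).map f).SortedGE := by
  apply List.Pairwise.sortedGE
  rw [List.pairwise_map]
  exact (Multiset.pairwise_sort p.parts (· ≥ ·)).imp fun h => hf h

/-- The major half of the center-justified diagram of a partition into odd parts `aᵢ = 2rᵢ - 1`:
the central line and the dots to its right, so row `i` has `rᵢ = (aᵢ + 1) / 2` dots. -/
def majorHalf {n : ℕ} (p : n.Partition) : YoungDiagram :=
  YoungDiagram.ofRowLens ((sortedParts p).map fun a => (a + 1) / 2)
    (sortedGE_map_sortedParts p fun _ _ h => Nat.div_le_div_right (Nat.add_le_add_right h 1))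

/-- The minor half of the center-justified diagram of a partition into odd parts `aᵢ = 2rᵢ - 1`:
the dots strictly to the left of the central line, moved to a left-justified diagram, so row `i`
has `rᵢ - 1 = (aᵢ - 1) / 2` dots (rows without dots disappear). -/
def minorHalf {n : ℕ} (p : n.Partition) : YoungDiagram :=
  YoungDiagram.ofRowLens ((sortedParts p).map fun a => (a - 1) / 2)
    (sortedGE_map_sortedParts p fun _ _ h => Nat.div_le_div_right (Nat.sub_le_sub_right h 1))

theorem card_majorHalf_add_card_minorHalf {n : ℕ} (p : n.Partition)
    (hp : ∀ a ∈ p.parts, Odd a) : (majorHalf p).card + (minorHalf p).card = n := by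
  rw [majorHalf, minorHalf, card_ofRowLens, card_ofRowLens]
  have hsum : (sortedParts p).sum = n := by
    rw [← Multiset.sum_coe, sortedParts, Multiset.sort_eq, p.parts_sum]
  have hodd : ∀ a ∈ sortedParts p, Odd a := fun a ha =>
    hp a (by rwa [sortedParts, Multiset.mem_sort] at ha)
  refine Eq.trans ?_ hsum
  clear hsum
  generalize sortedParts p = w at hodd
  induction w with
  | nil => simp
  | cons a w ih =>
    have h1 := ih fun b hb => hodd b (List.mem_cons_of_mem a hb)
    obtain ⟨m, hm⟩ := hodd a List.mem_cons_self
    simp only [List.map_cons, List.sum_cons]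
    omega

/-- The major-minor hook partition of a partition of `n` into odd parts: the partition of `n` whose
parts are the diagonal hook numbers of the major half together with those of the minor half. -/
def majorMinorHookPartition {n : ℕ} (p : n.Partition) (hp : ∀ a ∈ p.parts, Odd a) :
    n.Partition where
  parts := diagonalHooks (majorHalf p) + diagonalHooks (minorHalf p)
  parts_pos := fun h =>
    (Multiset.mem_add.1 h).elim (pos_of_mem_diagonalHooks _) (pos_of_mem_diagonalHooks _)
  parts_sum := by
    rw [Multiset.sum_add, sum_diagonalHooks, sum_diagonalHooks,
      card_majorHalf_add_card_minorHalf p hp]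

/-- `I` is a nonempty set of consecutive integers. -/
def IsConsecutive (I : Finset ℕ) : Prop :=
  ∃ a b : ℕ, a ≤ b ∧ I = Finset.Icc a b

open Classical in
/-- The maximal sequences of consecutive integers in `S`: the subsets of `S` that consist of
consecutive integers and are maximal, under inclusion, among such subsets. -/
noncomputable def maximalSequences (S : Finset ℕ) : Finset (Finset ℕ) :=
  S.powerset.filter (Maximal fun I => I ⊆ S ∧ IsConsecutive I)

end Sylvester

open Sylvester

namespace Sylvester

/-! ### Maximal sequences of consecutive integers -/

/-! The minor half is the major half `μ` without its first column, so the diagonal hooks of both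
halves are the hooks of `μ` at the staircase cells (0,0), (0,1), (1,1), (1,2), ..., the second kind
truncated by one column. Interleaved this way they form a strictly decreasing sequence
(`stairHook_strictAnti`), hence are distinct. Consecutive terms differ by 1 plus a drop in row
length or in column length (`stairHook_sub_succ`), so a new run starts exactly where such a drop is
positive, or at the first cell.

Runs are counted by their tops. A top at `(i, i)` is matched with the length of row `i`, a top at
`(i, i + 1)` with `i + 1`. A row length `v` comes from a top of the second kind if row `v - 1` is
longer than `v`, and otherwise from the first row of length `v`. Thus tops biject with the distinct
row lengths (`topRowLen_injOn`, `exists_isTop`, `card_tops`), and these with the distinct parts. -/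

theorem mem_maximalSequences {S I : Finset ℕ} :
    I ∈ maximalSequences S ↔ Maximal (fun I => I ⊆ S ∧ IsConsecutive I) I := by
  simp only [maximalSequences, Finset.mem_filter, Finset.mem_powerset]
  exact ⟨fun h => h.2, fun h => ⟨h.prop.1, h⟩⟩

theorem IsConsecutive.union {I J : Finset ℕ} (hI : IsConsecutive I) (hJ : IsConsecutive J)
    (h : ¬ Disjoint I J) : IsConsecutive (I ∪ J) := by
  obtain ⟨a, b, hab, rfl⟩ := hI
  obtain ⟨c, d, hcd, rfl⟩ := hJ
  obtain ⟨x, hx, hx'⟩ := Finset.not_disjoint_iff.1 h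
  rw [Finset.mem_Icc] at hx hx'
  refine ⟨min a c, max b d, by omega, ?_⟩
  ext y
  simp only [Finset.mem_union, Finset.mem_Icc]
  omega

/-- Overlapping intervals have an interval as union, so by maximality both equal that union. -/
theorem eq_of_mem_maximalSequences_of_not_disjoint {S I J : Finset ℕ}
    (hI : I ∈ maximalSequences S) (hJ : J ∈ maximalSequences S) (h : ¬ Disjoint I J) : I = J := by
  rw [mem_maximalSequences] at hI hJ
  have hU : I ∪ J ⊆ S ∧ IsConsecutive (I ∪ J) :=
    ⟨Finset.union_subset hI.prop.1 hJ.prop.1, hI.prop.2.union hJ.prop.2 h⟩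
  exact (hI.eq_of_le hU Finset.subset_union_left).trans
    (hJ.eq_of_le hU Finset.subset_union_right).symm

theorem pairwiseDisjoint_maximalSequences (S : Finset ℕ) :
    (maximalSequences S : Set (Finset ℕ)).Pairwise Disjoint := by
  intro I hI J hJ hne
  by_contra h
  exact hne (eq_of_mem_maximalSequences_of_not_disjoint hI hJ h)

theorem exists_mem_maximalSequences {S : Finset ℕ} {x : ℕ} (hx : x ∈ S) :
    ∃ I ∈ maximalSequences S, x ∈ I := by
  classical
  have hfin : {I : Finset ℕ | I ⊆ S ∧ IsConsecutive I}.Finite :=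
    S.powerset.finite_toSet.subset fun I hI => by simpa using hI.1
  obtain ⟨I, hle, hI⟩ := hfin.exists_le_maximal (a := {x})
    ⟨Finset.singleton_subset_iff.2 hx, x, x, le_rfl, by simp⟩
  exact ⟨I, mem_maximalSequences.2 hI, hle (Finset.mem_singleton_self x)⟩

theorem sum_val_maximalSequences (S : Finset ℕ) :
    ∑ I ∈ maximalSequences S, I.val = S.val := by
  have hd : (maximalSequences S : Set (Finset ℕ)).PairwiseDisjoint id :=
    fun I hI J hJ hne => pairwiseDisjoint_maximalSequences S hI hJ hne
  have h : S = (maximalSequences S).disjiUnion id hd := by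
    ext x
    rw [Finset.mem_disjiUnion]
    refine ⟨exists_mem_maximalSequences, ?_⟩
    rintro ⟨I, hI, hx⟩
    exact (mem_maximalSequences.1 hI).prop.1 hx
  conv_rhs => rw [h]
  rfl

theorem sup_Icc_id {a b : ℕ} (hab : a ≤ b) : (Finset.Icc a b).sup id = b :=
  le_antisymm (Finset.sup_le fun _ hx => (Finset.mem_Icc.1 hx).2)
    (Finset.le_sup (f := id) (Finset.mem_Icc.2 ⟨hab, le_rfl⟩))

/-- Maximal sequences are counted by their greatest elements. -/
theorem card_maximalSequences (S : Finset ℕ) :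
    (maximalSequences S).card = (S.filter fun x => x + 1 ∉ S).card := by
  have hsup : ∀ I ∈ maximalSequences S, I.sup id ∈ I := by
    intro I hI
    obtain ⟨a, b, hab, rfl⟩ := (mem_maximalSequences.1 hI).prop.2
    rw [sup_Icc_id hab, Finset.mem_Icc]
    exact ⟨hab, le_rfl⟩
  refine Finset.card_nbij (fun I => I.sup id) ?_ ?_ ?_
  · intro I hI
    have hmem := hsup I hI
    have hI' := mem_maximalSequences.1 hI
    refine Finset.mem_filter.2 ⟨hI'.prop.1 hmem, fun h => ?_⟩
    obtain ⟨a, b, hab, rfl⟩ := hI'.prop.2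
    simp only [sup_Icc_id hab] at h
    -- If `b + 1` were in `S`, the interval could be extended, against maximality.
    have hJ : Finset.Icc a (b + 1) ⊆ S ∧ IsConsecutive (Finset.Icc a (b + 1)) := by
      refine ⟨fun y hy => ?_, a, b + 1, by omega, rfl⟩
      rw [Finset.mem_Icc] at hy
      rcases hy.2.eq_or_lt with rfl | hlt
      · exact h
      · exact hI'.prop.1 (Finset.mem_Icc.2 ⟨hy.1, by omega⟩)
    have := hI'.le_of_ge hJ (Finset.Icc_subset_Icc_right (by omega))
      (Finset.mem_Icc.2 ⟨by omega, le_rfl⟩ : b + 1 ∈ _)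
    rw [Finset.mem_Icc] at this
    omega
  · intro I hI J hJ h
    exact eq_of_mem_maximalSequences_of_not_disjoint hI hJ
      (Finset.not_disjoint_iff.2 ⟨I.sup id, hsup I hI, by
        have := hsup J hJ
        simp only at h
        rwa [h]⟩)
  · intro x hx
    obtain ⟨hx, hx1⟩ := Finset.mem_filter.1 hx
    obtain ⟨I, hI, hxI⟩ := exists_mem_maximalSequences hx
    refine ⟨I, hI, ?_⟩
    have hI' := mem_maximalSequences.1 hI
    obtain ⟨a, b, hab, rfl⟩ := hI'.prop.2
    simp only [sup_Icc_id hab]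
    rw [Finset.mem_Icc] at hxI
    by_contra hne
    exact hx1 (hI'.prop.1 (Finset.mem_Icc.2 ⟨by omega, by omega⟩))

/-! ### Hook numbers -/

/-- Arm and leg share only the corner. -/
theorem hookNumber_add_eq {μ : YoungDiagram} {i : ℕ} (h : (i, i) ∈ μ) :
    hookNumber μ i i + 2 * i + 1 = μ.rowLen i + μ.colLen i := by
  have hr := YoungDiagram.mem_iff_lt_rowLen.1 h
  have hc := YoungDiagram.mem_iff_lt_colLen.1 h
  have harm : (arm μ i i).card = μ.rowLen i - i := by
    rw [← Nat.card_Ico, ← Finset.card_map (s := Finset.Ico i (μ.rowLen i))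
      ⟨fun j => (i, j), fun _ _ h => (Prod.ext_iff.1 h).2⟩]
    refine congrArg Finset.card ?_
    ext ⟨a, b⟩
    simp only [arm, Finset.mem_filter, YoungDiagram.mem_row_iff, YoungDiagram.mem_iff_lt_rowLen,
      Finset.mem_map, Finset.mem_Ico]
    constructor
    · rintro ⟨⟨h1, rfl⟩, h2⟩
      exact ⟨b, ⟨h2, h1⟩, rfl⟩
    · rintro ⟨b, ⟨h2, h1⟩, ⟨⟩⟩
      exact ⟨⟨h1, rfl⟩, h2⟩
  have hleg : (leg μ i i).card = μ.colLen i - i := by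
    rw [← Nat.card_Ico, ← Finset.card_map (s := Finset.Ico i (μ.colLen i))
      ⟨fun j => (j, i), fun _ _ h => (Prod.ext_iff.1 h).1⟩]
    refine congrArg Finset.card ?_
    ext ⟨a, b⟩
    simp only [leg, Finset.mem_filter, YoungDiagram.mem_col_iff, YoungDiagram.mem_iff_lt_colLen,
      Finset.mem_map, Finset.mem_Ico]
    constructor
    · rintro ⟨⟨h1, rfl⟩, h2⟩
      exact ⟨a, ⟨h2, h1⟩, rfl⟩
    · rintro ⟨b, ⟨h2, h1⟩, rfl, rfl⟩
      exact ⟨⟨h1, rfl⟩, h2⟩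
  have hinter : arm μ i i ∩ leg μ i i = {(i, i)} := by
    ext ⟨a, b⟩
    simp only [arm, leg, Finset.mem_inter, Finset.mem_filter, YoungDiagram.mem_row_iff,
      YoungDiagram.mem_col_iff, Finset.mem_singleton, Prod.mk.injEq]
    constructor
    · rintro ⟨⟨⟨_, h1⟩, _⟩, ⟨_, h2⟩, _⟩
      exact ⟨h1, h2⟩
    · rintro ⟨rfl, rfl⟩
      exact ⟨⟨⟨h, rfl⟩, le_rfl⟩, ⟨h, rfl⟩, le_rfl⟩
  have hcard := Finset.card_union_add_card_inter (arm μ i i) (leg μ i i)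
  rw [hinter, Finset.card_singleton, harm, hleg] at hcard
  rw [hookNumber, hook]
  omega

/-- The number `r (j / 2) + c ((j + 1) / 2) - j - 1`, where `r` and `c` are the row and column
lengths. For a cell `(j / 2, (j + 1) / 2)` of `μ` it is the number of dots in the hook with corner
`(j / 2, (j + 1) / 2)`; for odd `j` this is a diagonal hook of `μ` without its first column. -/
def stairHook (μ : YoungDiagram) (j : ℕ) : ℤ :=
  μ.rowLen (j / 2) + μ.colLen ((j + 1) / 2) - j - 1

/-- For even `j` the row difference vanishes, for odd `j` the column difference. -/
theorem stairHook_sub_succ (μ : YoungDiagram) (j : ℕ) :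
    stairHook μ j - stairHook μ (j + 1) = 1 + (μ.rowLen (j / 2) - μ.rowLen ((j + 1) / 2)) +
      (μ.colLen ((j + 1) / 2) - μ.colLen ((j + 1 + 1) / 2)) := by
  simp only [stairHook]
  push_cast
  ring

theorem stairHook_strictAnti (μ : YoungDiagram) : StrictAnti (stairHook μ) := by
  refine strictAnti_nat_of_succ_lt fun j => ?_
  have h := stairHook_sub_succ μ j
  have h1 := μ.rowLen_anti (j / 2) ((j + 1) / 2) (by omega)
  have h2 := μ.colLen_anti ((j + 1) / 2) ((j + 1 + 1) / 2) (by omega)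
  omega

theorem hookNumber_eq_stairHook {μ : YoungDiagram} {i : ℕ} (h : (i, i) ∈ μ) :
    (hookNumber μ i i : ℤ) = stairHook μ (2 * i) := by
  have := hookNumber_add_eq h
  rw [stairHook, show 2 * i / 2 = i by omega, show (2 * i + 1) / 2 = i by omega]
  push_cast
  omega

theorem hookNumber_eq_stairHook_of_shift {μ ν : YoungDiagram}
    (hν : ∀ i j, (i, j) ∈ ν ↔ (i, j + 1) ∈ μ) {i : ℕ} (h : (i, i) ∈ ν) :
    (hookNumber ν i i : ℤ) = stairHook μ (2 * i + 1) := by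
  have h0 := hookNumber_add_eq h
  have hc : ν.colLen i = μ.colLen (i + 1) := by
    refine eq_of_forall_lt_iff fun k => ?_
    rw [← YoungDiagram.mem_iff_lt_colLen, ← YoungDiagram.mem_iff_lt_colLen, hν]
  have hr : ν.rowLen i = μ.rowLen i - 1 := by
    refine eq_of_forall_lt_iff fun k => ?_
    rw [← YoungDiagram.mem_iff_lt_rowLen, hν, YoungDiagram.mem_iff_lt_rowLen]
    omega
  rw [hν, YoungDiagram.mem_iff_lt_rowLen] at h
  rw [stairHook, show (2 * i + 1) / 2 = i by omega, show (2 * i + 1 + 1) / 2 = i + 1 by omega]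
  push_cast
  omega

theorem mem_diagonalHooks {μ : YoungDiagram} {x : ℕ} :
    x ∈ diagonalHooks μ ↔ ∃ i, (i, i) ∈ μ ∧ hookNumber μ i i = x := by
  simp only [diagonalHooks, Multiset.mem_map, Multiset.mem_range, lt_durfeeSide_iff]

theorem mem_diagonalHooks_add {μ ν : YoungDiagram} (hν : ∀ i j, (i, j) ∈ ν ↔ (i, j + 1) ∈ μ)
    {x : ℕ} : x ∈ diagonalHooks μ + diagonalHooks ν ↔
      ∃ j, (j / 2, (j + 1) / 2) ∈ μ ∧ stairHook μ j = x := by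
  rw [Multiset.mem_add, mem_diagonalHooks, mem_diagonalHooks]
  constructor
  · rintro (⟨i, hi, rfl⟩ | ⟨i, hi, rfl⟩)
    · refine ⟨2 * i, ?_, (hookNumber_eq_stairHook hi).symm⟩
      rwa [show 2 * i / 2 = i by omega, show (2 * i + 1) / 2 = i by omega]
    · refine ⟨2 * i + 1, ?_, (hookNumber_eq_stairHook_of_shift hν hi).symm⟩
      rwa [show (2 * i + 1) / 2 = i by omega, show (2 * i + 1 + 1) / 2 = i + 1 by omega, ← hν]
  · rintro ⟨j, hj, hx⟩
    obtain ⟨i, rfl | rfl⟩ := Nat.even_or_odd' j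
    · rw [show 2 * i / 2 = i by omega, show (2 * i + 1) / 2 = i by omega] at hj
      exact Or.inl ⟨i, hj, by have := hookNumber_eq_stairHook hj; omega⟩
    · rw [show (2 * i + 1) / 2 = i by omega, show (2 * i + 1 + 1) / 2 = i + 1 by omega,
        ← hν] at hj
      exact Or.inr ⟨i, hj, by have := hookNumber_eq_stairHook_of_shift hν hj; omega⟩

/-- The two diagrams use even and odd indices of the injective `stairHook μ`. -/
theorem nodup_diagonalHooks_add {μ ν : YoungDiagram}
    (hν : ∀ i j, (i, j) ∈ ν ↔ (i, j + 1) ∈ μ) :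
    (diagonalHooks μ + diagonalHooks ν).Nodup := by
  have hinj := (stairHook_strictAnti μ).injective
  refine Multiset.nodup_add.2 ⟨?_, ?_, ?_⟩
  · refine Multiset.Nodup.map_on (fun i hi k hk h => ?_) (Multiset.nodup_range _)
    rw [Multiset.mem_range, lt_durfeeSide_iff] at hi hk
    have := hinj (a₁ := 2 * i) (a₂ := 2 * k) (by
      rw [← hookNumber_eq_stairHook hi, ← hookNumber_eq_stairHook hk, h])
    omega
  · refine Multiset.Nodup.map_on (fun i hi k hk h => ?_) (Multiset.nodup_range _)
    rw [Multiset.mem_range, lt_durfeeSide_iff] at hi hk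
    have := hinj (a₁ := 2 * i + 1) (a₂ := 2 * k + 1) (by
      rw [← hookNumber_eq_stairHook_of_shift hν hi, ← hookNumber_eq_stairHook_of_shift hν hk, h])
    omega
  · rw [Multiset.disjoint_left]
    intro x hx hx'
    obtain ⟨i, hi, rfl⟩ := mem_diagonalHooks.1 hx
    obtain ⟨k, hk, h⟩ := mem_diagonalHooks.1 hx'
    have := hinj (a₁ := 2 * i) (a₂ := 2 * k + 1) (by
      rw [← hookNumber_eq_stairHook hi, ← hookNumber_eq_stairHook_of_shift hν hk, h])
    omega

/-! ### Tops of sequences and distinct row lengths -/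

/-- `(j / 2, (j + 1) / 2)` is a cell of `μ`, and `stairHook μ j` is not one less than the preceding
term of the decreasing sequence `stairHook μ`. -/
def IsTop (μ : YoungDiagram) (j : ℕ) : Prop :=
  (j / 2, (j + 1) / 2) ∈ μ ∧ ∀ k, k + 1 = j → stairHook μ k ≠ stairHook μ j + 1

theorem isTop_even {μ : YoungDiagram} {i : ℕ} :
    IsTop μ (2 * i) ↔ i < μ.rowLen i ∧ ∀ k, k + 1 = i → μ.rowLen i < μ.rowLen k := by
  rw [IsTop, show 2 * i / 2 = i by omega, show (2 * i + 1) / 2 = i by omega,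
    YoungDiagram.mem_iff_lt_rowLen]
  refine and_congr_right fun _ => ?_
  obtain _ | k := i
  · simp
  · have h := stairHook_sub_succ μ (2 * k + 1)
    rw [show (2 * k + 1) / 2 = k by omega, show (2 * k + 1 + 1) / 2 = k + 1 by omega,
      show (2 * k + 1 + 1 + 1) / 2 = k + 1 by omega] at h
    have hanti := μ.rowLen_anti k (k + 1) (by omega)
    constructor
    · intro H l hl
      obtain rfl : l = k := by omega
      have := H (2 * l + 1) (by omega)
      rw [show 2 * (l + 1) = 2 * l + 1 + 1 by omega] at this
      omega
    · intro H l hl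
      obtain rfl : l = 2 * k + 1 := by omega
      have := H k rfl
      rw [show 2 * (k + 1) = 2 * k + 1 + 1 by omega]
      omega

theorem isTop_odd {μ : YoungDiagram} {i : ℕ} :
    IsTop μ (2 * i + 1) ↔ i + 1 < μ.rowLen i ∧ μ.colLen (i + 1) < μ.colLen i := by
  rw [IsTop, show (2 * i + 1) / 2 = i by omega, show (2 * i + 1 + 1) / 2 = i + 1 by omega,
    YoungDiagram.mem_iff_lt_rowLen]
  refine and_congr_right fun _ => ?_
  have h := stairHook_sub_succ μ (2 * i)
  rw [show 2 * i / 2 = i by omega, show (2 * i + 1) / 2 = i by omega,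
    show (2 * i + 1 + 1) / 2 = i + 1 by omega] at h
  have hanti := μ.colLen_anti i (i + 1) (by omega)
  constructor
  · intro H
    have := H (2 * i) rfl
    omega
  · intro H l hl
    obtain rfl : l = 2 * i := by omega
    omega

/-- The row length that is matched with a top. -/
def topRowLen (μ : YoungDiagram) (j : ℕ) : ℕ :=
  if Even j then μ.rowLen (j / 2) else (j + 1) / 2

theorem topRowLen_even (μ : YoungDiagram) (i : ℕ) : topRowLen μ (2 * i) = μ.rowLen i := by
  rw [topRowLen, if_pos (even_two_mul i), show 2 * i / 2 = i by omega]

theorem topRowLen_odd (μ : YoungDiagram) (i : ℕ) : topRowLen μ (2 * i + 1) = i + 1 := by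
  rw [topRowLen, if_neg (by simp), show (2 * i + 1 + 1) / 2 = i + 1 by omega]

/-- The rows of length `i + 1` are those ending in column `i`: the indices from `colLen (i + 1)` up
to, but excluding, `colLen i`. -/
theorem colLen_succ_lt_iff {μ : YoungDiagram} {i : ℕ} :
    μ.colLen (i + 1) < μ.colLen i ↔ ∃ q, μ.rowLen q = i + 1 := by
  have key : ∀ q, μ.rowLen q = i + 1 ↔ q < μ.colLen i ∧ ¬ q < μ.colLen (i + 1) := by
    intro q
    rw [← YoungDiagram.mem_iff_lt_colLen, ← YoungDiagram.mem_iff_lt_colLen,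
      YoungDiagram.mem_iff_lt_rowLen, YoungDiagram.mem_iff_lt_rowLen]
    omega
  simp only [key]
  exact ⟨fun h => ⟨_, h, lt_irrefl _⟩, fun ⟨q, h1, h2⟩ => by omega⟩

theorem topRowLen_mem {μ : YoungDiagram} {j : ℕ} (hj : IsTop μ j) :
    0 < topRowLen μ j ∧ ∃ q, μ.rowLen q = topRowLen μ j := by
  obtain ⟨i, rfl | rfl⟩ := Nat.even_or_odd' j
  · rw [topRowLen_even]
    exact ⟨by have := (isTop_even.1 hj).1; omega, i, rfl⟩
  · rw [topRowLen_odd]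
    exact ⟨by omega, colLen_succ_lt_iff.1 (isTop_odd.1 hj).2⟩

/-- An even top sits at the first row of its length. An even and an odd top cannot share the value
`i + 1`: the even one lies in a row `k ≤ i`, so row `i` has length at most `i + 1`, while the odd
one needs it longer. -/
theorem topRowLen_injOn (μ : YoungDiagram) : Set.InjOn (topRowLen μ) {j | IsTop μ j} := by
  have hlt : ∀ {i k : ℕ}, IsTop μ (2 * k) → i < k → μ.rowLen k < μ.rowLen i := by
    intro i k hk hik
    have h1 := (isTop_even.1 hk).2 (k - 1) (by omega)
    have h2 := μ.rowLen_anti i (k - 1) (by omega)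
    omega
  have hne : ∀ {i k : ℕ}, IsTop μ (2 * k) → IsTop μ (2 * i + 1) → μ.rowLen k ≠ i + 1 := by
    intro i k hk hi h
    have h1 := (isTop_even.1 hk).1
    have h2 := (isTop_odd.1 hi).1
    have h3 := μ.rowLen_anti k i (by omega)
    omega
  intro j hj l hl h
  obtain ⟨i, rfl | rfl⟩ := Nat.even_or_odd' j <;> obtain ⟨k, rfl | rfl⟩ := Nat.even_or_odd' l <;>
    simp only [topRowLen_even, topRowLen_odd] at h
  · rcases lt_trichotomy i k with hik | rfl | hik
    · have := hlt hl hik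
      omega
    · rfl
    · have := hlt hj hik
      omega
  · exact absurd h (hne hj hl)
  · exact absurd h.symm (hne hl hj)
  · omega

theorem exists_isTop {μ : YoungDiagram} {v : ℕ} (hv : 0 < v) (h : ∃ q, μ.rowLen q = v) :
    ∃ j, IsTop μ j ∧ topRowLen μ j = v := by
  obtain ⟨i, rfl⟩ : ∃ i, v = i + 1 := ⟨v - 1, by omega⟩
  by_cases hi : i + 1 < μ.rowLen i
  · exact ⟨2 * i + 1, isTop_odd.2 ⟨hi, colLen_succ_lt_iff.2 h⟩, topRowLen_odd μ i⟩
  · classical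
    have hq := Nat.find_spec h
    have hmin : ∀ k, k < Nat.find h → μ.rowLen k ≠ i + 1 := fun k hk => Nat.find_min h hk
    generalize Nat.find h = q at hq hmin
    -- Otherwise row `i` would be an earlier row of length exactly `i + 1`.
    have hqi : q ≤ i := by
      by_contra hlt
      have h1 := μ.rowLen_anti i q (by omega)
      exact hmin i (by omega) (by omega)
    refine ⟨2 * q, isTop_even.2 ⟨by omega, fun k hk => ?_⟩, by rw [topRowLen_even, hq]⟩
    have h1 := μ.rowLen_anti k q (by omega)
    have h2 := hmin k (by omega)
    omega

theorem card_tops {μ : YoungDiagram} {S V : Finset ℕ}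
    (hS : ∀ x, x ∈ S ↔ ∃ j, (j / 2, (j + 1) / 2) ∈ μ ∧ stairHook μ j = x)
    (hV : ∀ v, v ∈ V ↔ 0 < v ∧ ∃ q, μ.rowLen q = v) :
    (S.filter fun x => x + 1 ∉ S).card = V.card := by
  have htop : ∀ x, x ∈ S.filter (fun x => x + 1 ∉ S) ↔ ∃ j, IsTop μ j ∧ stairHook μ j = x := by
    intro x
    simp only [Finset.mem_filter, hS, IsTop]
    constructor
    · rintro ⟨⟨j, hj, hx⟩, hn⟩
      refine ⟨j, ⟨hj, ?_⟩, hx⟩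
      rintro k rfl h
      exact hn ⟨k, μ.up_left_mem (by omega) (by omega) hj, by push_cast; omega⟩
    · rintro ⟨j, ⟨hj, hk⟩, hx⟩
      refine ⟨⟨j, hj, hx⟩, ?_⟩
      rintro ⟨k, -, h⟩
      push_cast at h
      have hkj : k < j := (stairHook_strictAnti μ).lt_iff_gt.1 (by omega)
      -- Monotonicity squeezes the term at `j - 1` to exactly `x + 1`.
      have h1 := hk (j - 1) (by omega)
      have h2 := (stairHook_strictAnti μ).antitone (show k ≤ j - 1 by omega)
      have h3 := stairHook_strictAnti μ (show j - 1 < j by omega)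
      omega
  choose! g hg hgx using fun x hx => (htop x).1 hx
  refine Finset.card_nbij (fun x => topRowLen μ (g x)) ?_ ?_ ?_
  · intro x hx
    exact (hV _).2 (topRowLen_mem (hg x hx))
  · intro x hx y hy h
    have h1 := topRowLen_injOn μ (hg x hx) (hg y hy) h
    have h2 := hgx x hx
    rw [h1, hgx y hy] at h2
    exact_mod_cast h2.symm
  · intro v hv
    obtain ⟨hv0, hq⟩ := (hV v).1 hv
    obtain ⟨j, hj, rfl⟩ := exists_isTop hv0 hq
    -- `stairHook` is integer-valued; a top is a cell of `μ`, so its value is a natural number.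
    have hpos : 0 ≤ stairHook μ j := by
      have h1 := YoungDiagram.mem_iff_lt_rowLen.1 hj.1
      have h2 := YoungDiagram.mem_iff_lt_colLen.1 hj.1
      rw [stairHook]
      omega
    obtain ⟨x, hx⟩ := Int.eq_ofNat_of_zero_le hpos
    have hxS := (htop x).2 ⟨j, hj, hx⟩
    refine ⟨x, hxS, ?_⟩
    have := (stairHook_strictAnti μ).injective ((hgx x hxS).trans hx.symm)
    simp only [this]

/-! ### The two halves of a partition into odd parts -/

theorem mem_minorHalf_iff {n : ℕ} (p : n.Partition) (i j : ℕ) :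
    (i, j) ∈ minorHalf p ↔ (i, j + 1) ∈ majorHalf p := by
  rw [minorHalf, majorHalf, YoungDiagram.mem_ofRowLens, YoungDiagram.mem_ofRowLens]
  simp only [List.length_map, List.getElem_map]
  exact exists_congr fun _ => by omega

/-- Positivity of `v` excludes the zero lengths of rows beyond the last part. -/
theorem mem_image_parts_iff {n : ℕ} (p : n.Partition) (v : ℕ) :
    v ∈ p.parts.toFinset.image (fun a => (a + 1) / 2) ↔
      0 < v ∧ ∃ q, (majorHalf p).rowLen q = v := by
  have hmem : ∀ a, a ∈ p.parts ↔ a ∈ sortedParts p := fun a => by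
    rw [sortedParts, Multiset.mem_sort]
  have hrow : ∀ q (hq : q < (sortedParts p).length),
      (majorHalf p).rowLen q = ((sortedParts p)[q] + 1) / 2 := by
    intro q hq
    refine eq_of_forall_lt_iff fun k => ?_
    rw [← YoungDiagram.mem_iff_lt_rowLen, majorHalf, YoungDiagram.mem_ofRowLens]
    simp [hq]
  simp only [Finset.mem_image, Multiset.mem_toFinset]
  constructor
  · rintro ⟨a, ha, rfl⟩
    have hpos := p.parts_pos ha
    obtain ⟨q, hq, rfl⟩ := List.getElem_of_mem ((hmem a).1 ha)
    exact ⟨by omega, q, hrow q hq⟩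
  · rintro ⟨hv, q, rfl⟩
    have hq : q < (sortedParts p).length := by
      have h := hv
      rw [← YoungDiagram.mem_iff_lt_rowLen, majorHalf, YoungDiagram.mem_ofRowLens] at h
      simpa using h.1
    exact ⟨_, (hmem _).2 (List.getElem_mem hq), (hrow q hq).symm⟩

/-- Halving is injective on odd numbers. -/
theorem card_image_parts {n : ℕ} (p : n.Partition) (hp : ∀ a ∈ p.parts, Odd a) :
    (p.parts.toFinset.image fun a => (a + 1) / 2).card = p.parts.toFinset.card := by
  refine Finset.card_image_of_injOn fun a ha b hb h => ?_
  obtain ⟨c, rfl⟩ := hp a (by simpa using ha)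
  obtain ⟨d, rfl⟩ := hp b (by simpa using hb)
  omega

end Sylvester

open Sylvester
theorem mainTheorem2 (n : ℕ) (p : n.Partition) (hp : ∀ a ∈ p.parts, Odd a) (ℓ : ℕ)
    (hℓ : p.parts.toFinset.card = ℓ) :
    (maximalSequences (majorMinorHookPartition p hp).parts.toFinset).card = ℓ ∧
      (maximalSequences (majorMinorHookPartition p hp).parts.toFinset : Set (Finset ℕ)).Pairwise
        Disjoint ∧
      (majorMinorHookPartition p hp).parts =
        ∑ I ∈ maximalSequences (majorMinorHookPartition p hp).parts.toFinset, I.val := by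
  have hν := mem_minorHalf_iff p
  refine ⟨?_, pairwiseDisjoint_maximalSequences _, ?_⟩
  · rw [card_maximalSequences, ← hℓ, ← card_image_parts p hp]
    refine card_tops (μ := majorHalf p) (fun x => ?_) (mem_image_parts_iff p)
    rw [Multiset.mem_toFinset]
    exact mem_diagonalHooks_add hν
  · rw [sum_val_maximalSequences, Multiset.toFinset_val]
    exact (nodup_diagonalHooks_add hν).dedup.symm
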